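/- All graphs are finite, undirected and simple. For a graph $G$, let $\delta(G)$ be its minimum degree and $\alpha(G)$ its independence number. A $P_{\geq 3}$-factor of $G$ is a spanning subgraph of $G$ each of whose connected components is a path with at least $3$ vertices. The graph $G$ is a $P_{\geq 3}$-factor covered graph if every edge of $G$ lies in some $P_{\geq 3}$-factor of $G$, and a $P_{\geq 3}$-factor uniform graph if $G-e$ is a $P_{\geq 3}$-factor covered graph for every edge $e$ of $G$. Theorem. Let $G$ be a $2$-edge-connected graph. If $$\delta(G)>\frac{\alpha(G)+4}{2},$$ then $G$ is a $P_{\geq 3}$-factor uniform graph. Moreover, the strict inequality cannot be relaxed to $\geq$: for every integer $t\geq 0$, the graph $G=K_{3+t}\vee(4+2t)K_2$ (the join of the complete graph $K_{3+t}$ with the disjoint union of $4+2t$ copies of $K_2$) is $2$-edge-connected and satisfies $\delta(G)=\frac{\alpha(G)+4}{2}$, but it is not a $P_{\geq 3}$-factor uniform graph. -/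

import Mathlib

namespace SimpleGraph

/-- `F` is a `P_{≥ d}`-factor of `G`: a spanning subgraph of `G` (same vertex set, edges among
those of `G`) each of whose connected components is isomorphic to a path `P_n` with `n ≥ d`
vertices. -/
def IsPathFactor {V : Type*} (d : ℕ) (G F : SimpleGraph V) : Prop :=
  F ≤ G ∧ ∀ C : F.ConnectedComponent, ∃ n : ℕ, d ≤ n ∧ Nonempty (C.toSimpleGraph ≃g pathGraph n)

/-- `G` is a `P_{≥ d}`-factor covered graph: every edge of `G` belongs to some `P_{≥ d}`-factor
of `G`. -/
def IsPathFactorCovered {V : Type*} (d : ℕ) (G : SimpleGraph V) : Prop :=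
  ∀ e ∈ G.edgeSet, ∃ F : SimpleGraph V, IsPathFactor d G F ∧ e ∈ F.edgeSet

/-- `G` is a `P_{≥ d}`-factor uniform graph: `G - e` is a `P_{≥ d}`-factor covered graph for every
edge `e` of `G`. -/
def IsPathFactorUniform {V : Type*} (d : ℕ) (G : SimpleGraph V) : Prop :=
  ∀ e ∈ G.edgeSet, IsPathFactorCovered d (G.deleteEdges {e})

/-- The join `G ∨ H`: the disjoint union of `G` and `H` together with all edges between a vertex
of `G` and a vertex of `H`. -/
def graphJoin {V W : Type*} (G : SimpleGraph V) (H : SimpleGraph W) : SimpleGraph (V ⊕ W) :=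
  (G ⊕g H) ⊔ completeBipartiteGraph V W

/-- `m K_2`, the disjoint union of `m` copies of `K_2`; the vertex `(i, j)` is the `j`-th vertex of
the `i`-th copy. -/
def copiesK2 (m : ℕ) : SimpleGraph (Fin m × Fin 2) where
  Adj x y := x.1 = y.1 ∧ x.2 ≠ y.2
  symm := ⟨fun _ _ h => ⟨h.1.symm, h.2.symm⟩⟩
  loopless := ⟨fun _ h => h.2 rfl⟩

end SimpleGraph

/-! Fix the deleted edge `e` and an edge `xy` of `H = G - e`. Among families of disjoint paths of
`H` with at least three vertices, one of them running through `xy`, take one covering the most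
vertices; if it spans, its edges form the required factor. Otherwise some uncovered `u` has at least
δ - 1 covered neighbours in `H`. Maximality forbids every rerouting that absorbs `u`. Hence `u` sees
only inner vertices of the paths, at most one on a path avoiding `xy`, and the ends of the paths it
sees are pairwise nonadjacent and not adjacent to `u`, up to a loss of two ends on the path through
`xy` (`IsMaxPathPacking.exists_isIndepSet`). So `H` has an independent set of size 2(δ - 1) - 2 + 1,
and dropping an end of `e` leaves 2δ - 4 > α independent vertices of `G`, a contradiction.

For sharpness, delete the edge of one copy of K₂ and demand a clique edge. Removing the clique then
leaves 5 + 2t components with at most two vertices, each needing a factor edge to the clique, which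
can supply only 2(3 + t) - 2 of them. -/

namespace SimpleGraph

/-! ### Lists as paths: consecutive entries -/

section Packing

variable {V : Type*}

/-- `x` and `y` are consecutive entries of the list `l`, in one of the two orders. -/
def Consec (x y : V) (l : List V) : Prop := [x, y] <:+: l ∨ [y, x] <:+: l

theorem Consec.symm {x y : V} {l : List V} (h : Consec x y l) : Consec y x l := Or.symm h

theorem Consec.mono {x y : V} {l l' : List V} (h : Consec x y l) (hl : l <:+: l') :
    Consec x y l' :=
  h.imp (fun h => h.trans hl) (fun h => h.trans hl)

theorem consec_reverse {x y : V} {l : List V} : Consec x y l.reverse ↔ Consec x y l := by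
  have key : ∀ a b : V, [a, b] <:+: l.reverse ↔ [b, a] <:+: l := fun a b => by
    rw [← List.reverse_infix, List.reverse_reverse]; rfl
  rw [Consec, Consec, key, key, or_comm]

theorem Consec.mem_left {x y : V} {l : List V} (h : Consec x y l) : x ∈ l := by
  rcases h with h | h <;> exact h.subset (by simp)

theorem Consec.mem_right {x y : V} {l : List V} (h : Consec x y l) : y ∈ l := h.symm.mem_left

/-- The two pieces overlap in `q`, so no consecutive pair is cut. -/
theorem pair_infix_split {x y q : V} {A B : List V} (h : [x, y] <:+: A ++ q :: B) :
    [x, y] <:+: A ++ [q] ∨ [x, y] <:+: q :: B := by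
  rw [List.infix_append_iff] at h
  rcases h with h | h | ⟨l₁, l₂, h, h₁, h₂⟩
  · exact .inl (h.trans (List.prefix_append _ _).isInfix)
  · exact .inr h
  · rcases l₁ with _ | ⟨a, _ | ⟨b, l₁⟩⟩
    · simp at h; subst h; exact .inr h₂.isInfix
    · simp only [List.cons_append, List.nil_append, List.cons.injEq] at h
      obtain ⟨rfl, rfl⟩ := h
      rw [List.cons_prefix_cons] at h₂
      obtain ⟨rfl, -⟩ := h₂
      obtain ⟨s, rfl⟩ := h₁
      exact .inl ⟨s, [], by simp⟩
    · simp only [List.cons_append, List.cons.injEq] at h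
      obtain ⟨rfl, rfl, h⟩ := h
      simp only [List.nil_eq, List.append_eq_nil_iff] at h
      obtain ⟨rfl, rfl⟩ := h
      exact .inl (h₁.isInfix.trans (List.prefix_append _ _).isInfix)

theorem consec_split {x y q : V} {A B : List V} (h : Consec x y (A ++ q :: B)) :
    Consec x y (A ++ [q]) ∨ Consec x y (q :: B) := by
  rcases h with h | h
  · exact (pair_infix_split h).imp .inl .inl
  · exact (pair_infix_split h).imp .inr .inr

theorem consec_pair {x y q r : V} (h : Consec x y [q, r]) :
    (q = x ∧ r = y) ∨ (q = y ∧ r = x) := by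
  rcases h with h | h
  · have := h.eq_of_length rfl
    simp at this; exact .inl ⟨this.1.symm, this.2.symm⟩
  · have := h.eq_of_length rfl
    simp at this; exact .inr ⟨this.1.symm, this.2.symm⟩

theorem isChain_adj_reverse {H : SimpleGraph V} {l : List V} :
    l.reverse.IsChain H.Adj ↔ l.IsChain H.Adj := by
  rw [List.isChain_reverse]
  simp only [H.adj_comm]

/-! ### Path packings and exchanges -/

/-- Vertex-disjoint paths of `H`, each with at least three vertices and given by its list of
vertices, such that `x` and `y` are consecutive on one of them. -/
structure IsPathPacking (H : SimpleGraph V) (x y : V) (𝒞 : List (List V)) : Prop where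
  nodup : 𝒞.flatten.Nodup
  isChain : ∀ P ∈ 𝒞, P.IsChain H.Adj
  three_le : ∀ P ∈ 𝒞, 3 ≤ P.length
  consec : ∃ P ∈ 𝒞, Consec x y P

/-- A packing that covers as many vertices as possible. -/
structure IsMaxPathPacking (H : SimpleGraph V) (x y : V) (𝒞 : List (List V)) : Prop
    extends IsPathPacking H x y 𝒞 where
  max : ∀ 𝒬, IsPathPacking H x y 𝒬 → 𝒬.flatten.length ≤ 𝒞.flatten.length

variable {H : SimpleGraph V} {x y u : V} {𝒞 𝒬 ℛ : List (List V)}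

theorem IsPathPacking.perm (h : IsPathPacking H x y 𝒞) (hp : 𝒞.Perm 𝒬) :
    IsPathPacking H x y 𝒬 where
  nodup := hp.flatten.nodup_iff.1 h.nodup
  isChain P hP := h.isChain P (hp.mem_iff.2 hP)
  three_le P hP := h.three_le P (hp.mem_iff.2 hP)
  consec := let ⟨P, hP, hc⟩ := h.consec; ⟨P, hp.mem_iff.1 hP, hc⟩

theorem IsMaxPathPacking.perm (h : IsMaxPathPacking H x y 𝒞) (hp : 𝒞.Perm 𝒬) :
    IsMaxPathPacking H x y 𝒬 :=
  ⟨h.toIsPathPacking.perm hp, fun 𝒮 h𝒮 => hp.flatten.length_eq ▸ h.max 𝒮 h𝒮⟩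

/-- Replacing some paths of a packing by others that cover the same vertices and the new
vertices `us`. -/
theorem IsPathPacking.exchange {us : List V} {𝒩 : List (List V)}
    (h : IsPathPacking H x y (𝒬 ++ ℛ)) (hus : (us ++ (𝒬 ++ ℛ).flatten).Nodup)
    (hp : 𝒩.flatten.Perm (us ++ 𝒬.flatten))
    (hc : ∀ N ∈ 𝒩, N.IsChain H.Adj ∧ 3 ≤ N.length)
    (hf : ∀ Q ∈ 𝒬, Consec x y Q → ∃ N ∈ 𝒩, Consec x y N) :
    IsPathPacking H x y (𝒩 ++ ℛ) where
  nodup := by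
    rw [List.flatten_append, ← List.append_assoc] at hus
    rw [List.flatten_append]
    exact (hp.append_right _).nodup_iff.2 hus
  isChain P hP := by
    rcases List.mem_append.1 hP with hP | hP
    · exact (hc P hP).1
    · exact h.isChain P (List.mem_append_right _ hP)
  three_le P hP := by
    rcases List.mem_append.1 hP with hP | hP
    · exact (hc P hP).2
    · exact h.three_le P (List.mem_append_right _ hP)
  consec := by
    obtain ⟨P, hP, hxy⟩ := h.consec
    rcases List.mem_append.1 hP with hP | hP
    · obtain ⟨N, hN, hxy⟩ := hf P hP hxy
      exact ⟨N, List.mem_append_left _ hN, hxy⟩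
    · exact ⟨P, List.mem_append_right _ hP, hxy⟩

/-- The common engine: each forbidden configuration below is refuted by exhibiting `𝒩`, a rerouting
of the paths `𝒬` that also absorbs `us`. -/
theorem IsMaxPathPacking.no_exchange {us : List V} {𝒩 : List (List V)}
    (h : IsMaxPathPacking H x y (𝒬 ++ ℛ)) (hne : us ≠ []) (hus : (us ++ (𝒬 ++ ℛ).flatten).Nodup)
    (hp : 𝒩.flatten.Perm (us ++ 𝒬.flatten))
    (hc : ∀ N ∈ 𝒩, N.IsChain H.Adj ∧ 3 ≤ N.length)
    (hf : ∀ Q ∈ 𝒬, Consec x y Q → ∃ N ∈ 𝒩, Consec x y N) : False := by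
  have h1 := h.max _ (h.toIsPathPacking.exchange hus hp hc hf)
  have h2 := hp.length_eq
  have h3 := List.length_pos_iff.2 hne
  simp only [List.flatten_append, List.length_append] at h1 h2
  omega

theorem IsMaxPathPacking.reverse_head {Q : List V} (h : IsMaxPathPacking H x y (Q :: ℛ)) :
    IsMaxPathPacking H x y (Q.reverse :: ℛ) := by
  have h0 := h.toIsPathPacking
  refine ⟨IsPathPacking.exchange (us := []) (𝒬 := [Q]) (𝒩 := [Q.reverse]) h0 h0.nodup
    (by simp) ?_ ?_, fun 𝒮 h𝒮 => ?_⟩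
  · have h1 := h0.isChain Q (by simp)
    have h2 := h0.three_le Q (by simp)
    simp [isChain_adj_reverse, h1, h2]
  · simp [consec_reverse]
  · simpa using h.max 𝒮 h𝒮

theorem IsMaxPathPacking.not_adj_head {z : V} {A : List V}
    (h : IsMaxPathPacking H x y ((z :: A) :: ℛ)) (hu : u ∉ ((z :: A) :: ℛ).flatten) :
    ¬ H.Adj u z := fun huz => by
  refine h.no_exchange (us := [u]) (𝒬 := [z :: A]) (𝒩 := [u :: z :: A]) (by simp)
    (List.nodup_cons.2 ⟨hu, h.nodup⟩) (by simp) ?_ ?_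
  · have h1 := h.isChain (z :: A) (by simp)
    have h2 := h.three_le (z :: A) (by simp)
    simp only [List.mem_singleton, forall_eq, List.length_cons] at h2 ⊢
    exact ⟨List.isChain_cons_cons.2 ⟨huz, h1⟩, by omega⟩
  · simp only [List.mem_singleton, forall_eq, exists_eq_left]
    exact fun hc => hc.mono (List.suffix_cons _ _).isInfix

theorem IsMaxPathPacking.ne_nil_left {q : V} {A B : List V}
    (h : IsMaxPathPacking H x y ((A ++ q :: B) :: ℛ)) (hu : u ∉ ((A ++ q :: B) :: ℛ).flatten)
    (huq : H.Adj u q) : A ≠ [] := by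
  rintro rfl
  exact h.not_adj_head hu huq

theorem IsMaxPathPacking.ne_nil_right {q : V} {A B : List V}
    (h : IsMaxPathPacking H x y ((A ++ q :: B) :: ℛ)) (hu : u ∉ ((A ++ q :: B) :: ℛ).flatten)
    (huq : H.Adj u q) : B ≠ [] := by
  have h' := h.reverse_head
  rw [List.reverse_append, List.reverse_cons, List.append_assoc, List.singleton_append] at h'
  have := h'.ne_nil_left (u := u) (by simpa [or_comm, or_left_comm] using hu) huq
  simpa using this

/-- An uncovered vertex has at most one neighbour on a path of a maximum packing, unless its
neighbours are `x` and `y`. -/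
theorem IsMaxPathPacking.two_neighbors {q r : V} {A M B : List V}
    (h : IsMaxPathPacking H x y ((A ++ q :: (M ++ r :: B)) :: ℛ))
    (hu : u ∉ ((A ++ q :: (M ++ r :: B)) :: ℛ).flatten)
    (huq : H.Adj u q) (hur : H.Adj u r) :
    M = [] ∧ ((q = x ∧ r = y) ∨ (q = y ∧ r = x)) := by
  have hA := h.ne_nil_left hu huq
  have hB : B ≠ [] := IsMaxPathPacking.ne_nil_right (A := A ++ q :: M) (q := r) (u := u) (ℛ := ℛ)
    (by simpa using h) (by simpa using hu) hur
  have hch := h.isChain (A ++ q :: (M ++ r :: B)) (by simp)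
  have hAq : (A ++ [q]).IsChain H.Adj := (List.isChain_split.1 hch).1
  have hqMr : (q :: M ++ [r]).IsChain H.Adj :=
    (List.isChain_split.1 (List.cons_append ▸ (List.isChain_split.1 hch).2)).1
  have hrB : (r :: B).IsChain H.Adj :=
    ((List.isChain_split (l₁ := q :: M)).1 (by simpa using (List.isChain_split.1 hch).2)).2
  have hApos := List.length_pos_iff.2 hA
  have hBpos := List.length_pos_iff.2 hB
  have hnd : ([u] ++ ([A ++ q :: (M ++ r :: B)] ++ ℛ).flatten).Nodup :=
    List.nodup_cons.2 ⟨hu, h.nodup⟩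
  classical
  have hM : M = [] := by
    by_contra hM
    have hMpos := List.length_pos_iff.2 hM
    -- The path can be cut just before `r` or just after `q`, with `u` attached to the shorter
    -- piece. The choice depends on where `xy` lies; `A`, `M`, `B` being nonempty keeps both pieces
    -- long enough.
    by_cases hf : Consec x y (q :: M)
    · refine h.no_exchange (us := [u]) (𝒬 := [A ++ q :: (M ++ r :: B)])
        (𝒩 := [A ++ q :: M, u :: r :: B]) (by simp) hnd ?_ ?_ ?_
      · rw [List.perm_iff_count]; intro a
        simp [List.count_cons]; omega
      · simp only [List.mem_cons, List.not_mem_nil, or_false, forall_eq_or_imp, forall_eq,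
          List.length_append, List.length_cons]
        refine ⟨⟨List.isChain_split.2 ⟨hAq, ?_⟩, by omega⟩,
          List.isChain_cons_cons.2 ⟨hur, hrB⟩, by omega⟩
        exact hqMr.left_of_append
      · simp only [List.mem_singleton, forall_eq]
        exact fun _ => ⟨A ++ q :: M, by simp, hf.mono (List.suffix_append _ _).isInfix⟩
    · refine h.no_exchange (us := [u]) (𝒬 := [A ++ q :: (M ++ r :: B)])
        (𝒩 := [A ++ [q, u], M ++ r :: B]) (by simp) hnd ?_ ?_ ?_
      · rw [List.perm_iff_count]; intro a
        simp [List.count_cons]; omega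
      · simp only [List.mem_cons, List.not_mem_nil, or_false, forall_eq_or_imp, forall_eq,
          List.length_append, List.length_cons]
        refine ⟨⟨List.isChain_split.2 ⟨hAq, ?_⟩, by simp; omega⟩,
          List.isChain_split.2 ⟨?_, hrB⟩, by omega⟩
        · simpa using huq.symm
        · exact List.IsChain.right_of_append (l₁ := [q]) hqMr
      · simp only [List.mem_singleton, forall_eq]
        intro hxy
        rcases consec_split hxy with h1 | h1
        · exact ⟨A ++ [q, u], by simp, h1.mono ⟨[], [u], by simp⟩⟩
        obtain ⟨m, M', rfl⟩ := List.exists_cons_of_ne_nil hM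
        rcases consec_split (A := [q]) (q := m) (B := M' ++ r :: B) (by simpa using h1) with h2 | h2
        · exact absurd (h2.mono ⟨[], M', by simp⟩) hf
        · exact ⟨_, List.mem_cons_of_mem _ (List.mem_singleton_self _), by simpa using h2⟩
  subst hM
  refine ⟨rfl, ?_⟩
  by_contra hne
  -- Inserting `u` between `q` and `r` destroys only the edge `qr`.
  refine h.no_exchange (us := [u]) (𝒬 := [A ++ q :: ([] ++ r :: B)])
    (𝒩 := [A ++ q :: u :: r :: B]) (by simp) hnd ?_ ?_ ?_
  · rw [List.perm_iff_count]; intro a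
    simp [List.count_cons]; omega
  · simp only [List.mem_singleton, forall_eq, List.length_append, List.length_cons]
    exact ⟨List.isChain_split.2 ⟨hAq, List.isChain_cons_cons.2 ⟨huq.symm,
      List.isChain_cons_cons.2 ⟨hur, hrB⟩⟩⟩, by omega⟩
  · simp only [List.mem_singleton, forall_eq, exists_eq_left, List.nil_append]
    intro hxy
    rcases consec_split hxy with h1 | h1
    · exact h1.mono ⟨[], u :: r :: B, by simp⟩
    rcases consec_split (A := [q]) (q := r) h1 with h2 | h2
    · exact absurd (consec_pair h2) hne
    · exact h2.mono ⟨A ++ [q, u], [], by simp⟩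

/-- An edge `zz'` would close the path to a cycle. Opened at one of the two path edges at `q`, it
becomes a path that `u` extends, and at least one of these openings spares `xy`. -/
theorem IsMaxPathPacking.not_adj_ends {q z z' : V} {A B : List V}
    (h : IsMaxPathPacking H x y ((z :: A ++ q :: B ++ [z']) :: ℛ))
    (hu : u ∉ ((z :: A ++ q :: B ++ [z']) :: ℛ).flatten) (huq : H.Adj u q) :
    ¬ H.Adj z z' := fun hzz => by
  have hnd : ([u] ++ ([z :: A ++ q :: B ++ [z']] ++ ℛ).flatten).Nodup :=
    List.nodup_cons.2 ⟨hu, h.nodup⟩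
  have hch := h.isChain (z :: A ++ q :: B ++ [z']) (by simp)
  rw [List.append_assoc, List.cons_append (as := B)] at hch
  obtain ⟨h1, h2⟩ := List.isChain_split.1 hch
  classical
  by_cases hf : Consec x y (z :: A ++ [q])
  · refine h.no_exchange (us := [u]) (𝒬 := [z :: A ++ q :: B ++ [z']])
      (𝒩 := [u :: q :: A.reverse ++ z :: z' :: B.reverse]) (by simp) hnd ?_ ?_ ?_
    · rw [List.perm_iff_count]; intro a
      simp [List.count_cons]; omega
    · simp only [List.mem_singleton, forall_eq, List.length_append, List.length_cons]
      refine ⟨?_, by omega⟩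
      refine List.isChain_split.2 ⟨?_, List.isChain_cons_cons.2 ⟨hzz, ?_⟩⟩
      · rw [← isChain_adj_reverse] at h1
        simp only [List.cons_append] at h1 ⊢
        exact List.isChain_cons_cons.2 ⟨huq, by simpa using h1⟩
      · rw [← isChain_adj_reverse] at h2
        simp only [List.reverse_cons, List.reverse_append] at h2
        exact h2.left_of_append
    · simp only [List.mem_singleton, forall_eq, exists_eq_left]
      intro _
      rw [← consec_reverse] at hf
      exact hf.mono ⟨[u], z' :: B.reverse, by simp⟩
  · refine h.no_exchange (us := [u]) (𝒬 := [z :: A ++ q :: B ++ [z']])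
      (𝒩 := [u :: q :: B ++ z' :: z :: A]) (by simp) hnd ?_ ?_ ?_
    · rw [List.perm_iff_count]; intro a
      simp [List.count_cons]; omega
    · simp only [List.mem_singleton, forall_eq, List.length_append, List.length_cons]
      refine ⟨?_, by omega⟩
      refine List.isChain_split.2 ⟨?_, List.isChain_cons_cons.2 ⟨hzz.symm, ?_⟩⟩
      · exact List.isChain_cons_cons.2 ⟨huq, h2⟩
      · exact h1.left_of_append
    · simp only [List.mem_singleton, forall_eq, exists_eq_left]
      intro hxy
      rw [List.append_assoc, List.cons_append (as := B)] at hxy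
      rcases consec_split hxy with h3 | h3
      · exact absurd h3 hf
      · exact h3.mono ⟨[u], z :: A, by simp⟩

/-- With the edge `zz'`, the two legs could be cut off and joined to each other, while `u` joins the
two remainders through `q` and `q'`. -/
theorem IsMaxPathPacking.not_adj_legs {q z q' z' : V} {A B A' B' : List V}
    (h : IsMaxPathPacking H x y ((z :: A ++ q :: B) :: (z' :: A' ++ q' :: B') :: ℛ))
    (hu : u ∉ ((z :: A ++ q :: B) :: (z' :: A' ++ q' :: B') :: ℛ).flatten)
    (huq : H.Adj u q) (huq' : H.Adj u q') (hB : B ≠ []) (hB' : B' ≠ [])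
    (hf : Consec x y (z :: A ++ q :: B) → Consec x y (q :: B))
    (hf' : Consec x y (z' :: A' ++ q' :: B') → Consec x y (q' :: B')) :
    ¬ H.Adj z z' := fun hzz => by
  have hnd : ([u] ++ ([z :: A ++ q :: B, z' :: A' ++ q' :: B'] ++ ℛ).flatten).Nodup :=
    List.nodup_cons.2 ⟨hu, h.nodup⟩
  obtain ⟨h1, h2⟩ := List.isChain_split.1 (h.isChain (z :: A ++ q :: B) (by simp))
  obtain ⟨h1', h2'⟩ := List.isChain_split.1 (h.isChain (z' :: A' ++ q' :: B') (by simp))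
  have hBpos := List.length_pos_iff.2 hB
  have hBpos' := List.length_pos_iff.2 hB'
  classical
  -- Two one-vertex legs would join to a path that is too short; instead `u` takes the place of `z`,
  -- and `z` is prepended to the other path.
  by_cases hA : A = [] ∧ A' = []
  · obtain ⟨rfl, rfl⟩ := hA
    refine h.no_exchange (us := [u]) (𝒬 := [z :: [] ++ q :: B, z' :: [] ++ q' :: B'])
      (𝒩 := [u :: q :: B, z :: z' :: q' :: B']) (by simp) hnd ?_ ?_ ?_
    · rw [List.perm_iff_count]; intro a
      simp [List.count_cons]; omega
    · simp only [List.mem_cons, List.not_mem_nil, or_false, forall_eq_or_imp, forall_eq,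
        List.length_cons]
      refine ⟨⟨List.isChain_cons_cons.2 ⟨huq, h2⟩, by omega⟩,
        List.isChain_cons_cons.2 ⟨hzz, List.isChain_cons_cons.2 ⟨?_, h2'⟩⟩, by omega⟩
      simpa using h1'
    · simp only [List.mem_cons, List.not_mem_nil, or_false, forall_eq_or_imp, forall_eq]
      exact ⟨fun hc => ⟨_, .inl rfl, (hf hc).mono ⟨[u], [], by simp⟩⟩,
        fun hc => ⟨_, .inr rfl, (hf' hc).mono ⟨[z, z'], [], by simp⟩⟩⟩
  · refine h.no_exchange (us := [u]) (𝒬 := [z :: A ++ q :: B, z' :: A' ++ q' :: B'])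
      (𝒩 := [B.reverse ++ q :: u :: q' :: B', A.reverse ++ z :: z' :: A']) (by simp) hnd ?_ ?_ ?_
    · rw [List.perm_iff_count]; intro a
      simp [List.count_cons]; omega
    · have hlen : 1 ≤ A.length + A'.length := by
        by_contra hlt
        exact hA ⟨List.length_eq_zero_iff.1 (by omega), List.length_eq_zero_iff.1 (by omega)⟩
      simp only [List.mem_cons, List.not_mem_nil, or_false, forall_eq_or_imp, forall_eq,
        List.length_append, List.length_cons, List.length_reverse]
      refine ⟨⟨List.isChain_split.2 ⟨?_, List.isChain_cons_cons.2 ⟨huq.symm,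
        List.isChain_cons_cons.2 ⟨huq', h2'⟩⟩⟩, by omega⟩,
        List.isChain_split.2 ⟨?_, List.isChain_cons_cons.2 ⟨hzz, h1'.left_of_append⟩⟩, by omega⟩
      · simpa using isChain_adj_reverse.2 h2
      · simpa using isChain_adj_reverse.2 h1.left_of_append
    · simp only [List.mem_cons, List.not_mem_nil, or_false, forall_eq_or_imp, forall_eq]
      exact ⟨fun hc => ⟨_, .inl rfl, (consec_reverse.2 (hf hc)).mono ⟨[], u :: q' :: B', by simp⟩⟩,
        fun hc => ⟨_, .inl rfl, (hf' hc).mono ⟨B.reverse ++ [q, u], [], by simp⟩⟩⟩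

/-! ### Leg ends and the independent set -/

/-- `z` is an end of the path `P`, and `u` has a neighbour `q ≠ z` on `P` that is not the other end,
such that the part of `P` before `q`, seen from `z`, can be cut off without destroying `xy`. -/
def IsLegEnd (H : SimpleGraph V) (x y u : V) (P : List V) (z : V) : Prop :=
  ∃ (q : V) (A B : List V), (P = z :: A ++ q :: B ∨ P.reverse = z :: A ++ q :: B) ∧ B ≠ [] ∧
    H.Adj u q ∧ (Consec x y P → Consec x y (q :: B))

theorem IsMaxPathPacking.of_eq_or_reverse_eq {P Q : List V} (h : IsMaxPathPacking H x y (P :: ℛ))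
    (hu : u ∉ (P :: ℛ).flatten) (hQ : P = Q ∨ P.reverse = Q) :
    IsMaxPathPacking H x y (Q :: ℛ) ∧ u ∉ (Q :: ℛ).flatten := by
  obtain rfl | rfl := hQ
  · exact ⟨h, hu⟩
  · exact ⟨h.reverse_head, by simpa using hu⟩

theorem IsMaxPathPacking.not_adj_legEnd (h : IsMaxPathPacking H x y 𝒞) (hu : u ∉ 𝒞.flatten)
    {P : List V} (hP : P ∈ 𝒞) {z : V} (hz : IsLegEnd H x y u P z) : ¬ H.Adj u z := by
  classical
  obtain ⟨q, A, B, hQ, -⟩ := hz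
  have hp := List.perm_cons_erase hP
  obtain ⟨h1, h2⟩ := (h.perm hp).of_eq_or_reverse_eq (u := u)
    (fun hm => hu (hp.flatten.mem_iff.2 hm)) hQ
  exact h1.not_adj_head h2

theorem IsMaxPathPacking.not_adj_of_isLegEnd (h : IsMaxPathPacking H x y 𝒞) (hu : u ∉ 𝒞.flatten)
    {P P' : List V} (hP : P ∈ 𝒞) (hP' : P' ∈ 𝒞) {z z' : V} (hz : IsLegEnd H x y u P z)
    (hz' : IsLegEnd H x y u P' z') : ¬ H.Adj z z' := by
  classical
  obtain ⟨q, A, B, hQ, hB, huq, hf⟩ := hz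
  obtain ⟨q', A', B', hQ', hB', huq', hf'⟩ := hz'
  have hp := List.perm_cons_erase hP
  have hu1 : u ∉ (P :: 𝒞.erase P).flatten := fun hm => hu (hp.flatten.mem_iff.2 hm)
  by_cases hPP : P = P'
  · subst hPP
    obtain ⟨h1, h2⟩ := (h.perm hp).of_eq_or_reverse_eq hu1 hQ
    -- Leg ends of the same path coincide or are its two opposite ends.
    have hcases : z = z' ∨ (z :: A ++ q :: B).reverse = z' :: A' ++ q' :: B' := by
      rcases hQ with hQ | hQ <;> rcases hQ' with hQ' | hQ' <;> rw [← hQ]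
      · have := hQ.symm.trans hQ'
        simp only [List.cons_append, List.cons.injEq] at this
        exact .inl this.1
      · exact .inr hQ'
      · exact .inr (by simpa using hQ')
      · have := hQ.symm.trans hQ'
        simp only [List.cons_append, List.cons.injEq] at this
        exact .inl this.1
    rcases hcases with rfl | hr
    · exact H.irrefl
    · obtain ⟨B₀, b, rfl⟩ := List.eq_nil_or_concat' B |>.resolve_left hB
      have hb : b = z' := by
        simp only [List.reverse_append, List.reverse_cons, List.cons_append, List.nil_append,
          List.append_assoc, List.reverse_nil, List.cons.injEq] at hr
        exact hr.1
      subst hb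
      rw [← List.cons_append, ← List.append_assoc] at h1 h2
      exact h1.not_adj_ends h2 huq
  · have hp2 := List.perm_cons_erase ((List.mem_erase_of_ne (Ne.symm hPP)).2 hP')
    obtain ⟨h1, h2⟩ := ((h.perm hp).perm (hp2.cons P)).of_eq_or_reverse_eq
      (fun hm => hu1 ((hp2.cons P).flatten.mem_iff.2 hm)) hQ
    have hsw := List.Perm.swap P' (z :: A ++ q :: B) ((𝒞.erase P).erase P')
    obtain ⟨h3, h4⟩ := (h1.perm hsw).of_eq_or_reverse_eq
      (fun hm => h2 (hsw.flatten.mem_iff.2 hm)) hQ'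
    have hsw' := List.Perm.swap (z :: A ++ q :: B) (z' :: A' ++ q' :: B') ((𝒞.erase P).erase P')
    refine (h3.perm hsw').not_adj_legs (fun hm => h4 (hsw'.flatten.mem_iff.2 hm)) huq huq' hB hB'
      ?_ ?_
    · rcases hQ with hQ | hQ <;> rw [← hQ]
      · exact hf
      · rwa [consec_reverse]
    · rcases hQ' with hQ' | hQ' <;> rw [← hQ']
      · exact hf'
      · rwa [consec_reverse]

-- Without `xy` on `P`, a neighbour of `u` is unique and inner, so it makes both ends leg ends. With
-- `xy` on `P`, two neighbours must be `x` and `y`, and both ends still count; a single neighbour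
-- may yield no leg end. The extra 2 covers both cases.
open Classical in
theorem IsMaxPathPacking.two_mul_countP_le (h : IsMaxPathPacking H x y 𝒞) (hu : u ∉ 𝒞.flatten)
    {P : List V} (hP : P ∈ 𝒞) :
    2 * P.countP (H.Adj u ·) ≤ P.countP (IsLegEnd H x y u P ·) + if Consec x y P then 2 else 0 := by
  have hp := List.perm_cons_erase hP
  replace h := h.perm hp
  replace hu : u ∉ (P :: 𝒞.erase P).flatten := fun hm => hu (hp.flatten.mem_iff.2 hm)
  generalize 𝒞.erase P = ℛ at h hu
  clear hp hP
  have hnd : P.Nodup := (List.nodup_flatten.1 h.nodup).1 P (by simp)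
  have count_ends : ∀ z z' A, P = z :: A ++ [z'] → IsLegEnd H x y u P z → IsLegEnd H x y u P z' →
      2 ≤ P.countP (IsLegEnd H x y u P ·) := by
    intro z z' A hPe hz hz'
    generalize IsLegEnd H x y u P = p at hz hz'
    subst hPe
    simp [List.countP_append, hz, hz']
  have two : ∀ A q M r B, P = A ++ q :: (M ++ r :: B) → H.Adj u q → H.Adj u r →
      2 * P.countP (H.Adj u ·) ≤
        P.countP (IsLegEnd H x y u P ·) + if Consec x y P then 2 else 0 := by
    intro A q M r B hPe huq hur
    have hA := IsMaxPathPacking.ne_nil_left (hPe ▸ h) (hPe ▸ hu) huq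
    have hB : B ≠ [] := IsMaxPathPacking.ne_nil_right (A := A ++ q :: M) (q := r) (u := u) (ℛ := ℛ)
      (by rw [hPe] at h; simpa using h) (by rw [hPe] at hu; simpa using hu) hur
    obtain ⟨rfl, hqr⟩ := IsMaxPathPacking.two_neighbors (hPe ▸ h) (hPe ▸ hu) huq hur
    have hcon : Consec x y [q, r] := by
      rcases hqr with ⟨rfl, rfl⟩ | ⟨rfl, rfl⟩
      · exact .inl (List.infix_refl _)
      · exact .inr (List.infix_refl _)
    have hcP : Consec x y P := hcon.mono ⟨A, B, by simp [hPe]⟩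
    rw [List.nil_append] at hPe
    have hnd' := hnd
    rw [hPe, List.nodup_append] at hnd'
    obtain ⟨-, hnd1, hdisj⟩ := hnd'
    have cA : A.countP (H.Adj u ·) = 0 := by
      rw [List.countP_eq_zero]
      intro s hs hus
      rw [decide_eq_true_iff] at hus
      obtain ⟨A₁, A₂, rfl⟩ := List.append_of_mem hs
      have he : P = A₁ ++ s :: (A₂ ++ q :: (r :: B)) := by simp [hPe]
      have := (IsMaxPathPacking.two_neighbors (he ▸ h) (he ▸ hu) hus huq).2
      have hsr : s = r := by grind
      exact hdisj s hs r (by simp) hsr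
    have cB : B.countP (H.Adj u ·) = 0 := by
      rw [List.countP_eq_zero]
      intro s hs hus
      rw [decide_eq_true_iff] at hus
      obtain ⟨B₁, B₂, rfl⟩ := List.append_of_mem hs
      have he : P = A ++ q :: (r :: B₁ ++ s :: B₂) := by simp [hPe]
      have := (IsMaxPathPacking.two_neighbors (he ▸ h) (he ▸ hu) huq hus).1
      simp at this
    have c2 : P.countP (H.Adj u ·) = 2 := by
      rw [hPe]; simp [List.countP_append, cA, cB, huq, hur]
    obtain ⟨z, A', rfl⟩ := List.exists_cons_of_ne_nil hA
    obtain ⟨B', z', rfl⟩ := List.eq_nil_or_concat' B |>.resolve_left hB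
    -- Each end uses the nearer of `q` and `r`, so the part kept contains the edge `qr`, which is
    -- `xy`.
    have := count_ends z z' (A' ++ q :: r :: B') (by simp [hPe])
      ⟨q, A', _, .inl hPe, by simp, huq, fun _ => hcon.mono ⟨[], B' ++ [z'], by simp⟩⟩
      ⟨r, B'.reverse, q :: (A'.reverse ++ [z]), .inr (by simp [hPe]), by simp, hur,
        fun _ => (consec_reverse.2 hcon).mono ⟨[], A'.reverse ++ [z], by simp⟩⟩
    rw [if_pos hcP]
    omega
  by_cases hN : ∃ q ∈ P, H.Adj u q
  swap
  · have : P.countP (H.Adj u ·) = 0 := by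
      rw [List.countP_eq_zero]
      simpa using hN
    omega
  obtain ⟨q, hq, huq⟩ := hN
  obtain ⟨A, B, hPe⟩ := List.append_of_mem hq
  by_cases hNB : ∃ r ∈ B, H.Adj u r
  · obtain ⟨r, hr, hur⟩ := hNB
    obtain ⟨B₁, B₂, rfl⟩ := List.append_of_mem hr
    exact two _ _ _ _ _ hPe huq hur
  by_cases hNA : ∃ r ∈ A, H.Adj u r
  · obtain ⟨r, hr, hur⟩ := hNA
    obtain ⟨A₁, A₂, rfl⟩ := List.append_of_mem hr
    exact two A₁ r A₂ q B (by simp [hPe]) hur huq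
  have cA : A.countP (H.Adj u ·) = 0 := by
    rw [List.countP_eq_zero]; simpa using hNA
  have cB : B.countP (H.Adj u ·) = 0 := by
    rw [List.countP_eq_zero]; simpa using hNB
  have c1 : P.countP (H.Adj u ·) = 1 := by
    rw [hPe]; simp [List.countP_append, cA, cB, huq]
  rw [c1]
  split_ifs with hc
  · omega
  have hA := IsMaxPathPacking.ne_nil_left (hPe ▸ h) (hPe ▸ hu) huq
  have hB := IsMaxPathPacking.ne_nil_right (hPe ▸ h) (hPe ▸ hu) huq
  obtain ⟨z, A', rfl⟩ := List.exists_cons_of_ne_nil hA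
  obtain ⟨B', z', rfl⟩ := List.eq_nil_or_concat' B |>.resolve_left hB
  have := count_ends z z' (A' ++ q :: B') (by simp [hPe])
    ⟨q, A', _, .inl hPe, by simp, huq, fun h => absurd h hc⟩
    ⟨q, B'.reverse, A'.reverse ++ [z], .inr (by simp [hPe]), by simp, huq, fun h => absurd h hc⟩
  omega

open Classical in
/-- The ends of the legs seen from an uncovered vertex `u`, together with `u`, are independent, and
there are many of them if `u` has many covered neighbours. -/
theorem IsMaxPathPacking.exists_isIndepSet (h : IsMaxPathPacking H x y 𝒞) (hu : u ∉ 𝒞.flatten) :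
    ∃ I : Finset V, H.IsIndepSet I ∧ 2 * 𝒞.flatten.countP (H.Adj u ·) ≤ I.card + 1 := by
  set p : V → Prop := fun z => ∃ P ∈ 𝒞, IsLegEnd H x y u P z with hp
  -- By disjointness a single path carries `xy`, so the loss of 2 occurs once.
  have hle : 2 * 𝒞.flatten.countP (H.Adj u ·) ≤ 𝒞.flatten.countP (p ·) + 2 := by
    have hsum : ∀ 𝒟 : List (List V), (∀ P ∈ 𝒟, P ∈ 𝒞) → (∀ P ∈ 𝒟, ¬ Consec x y P) →
        2 * 𝒟.flatten.countP (H.Adj u ·) ≤ 𝒟.flatten.countP (p ·) := by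
      intro 𝒟
      induction 𝒟 with
      | nil => simp
      | cons P 𝒟 ih =>
        intro h1 h2
        have ih := ih (fun Q hQ => h1 Q (by simp [hQ])) (fun Q hQ => h2 Q (by simp [hQ]))
        have hP := h.two_mul_countP_le hu (h1 P (by simp))
        rw [if_neg (h2 P (by simp))] at hP
        have hm : P.countP (IsLegEnd H x y u P ·) ≤ P.countP (p ·) :=
          List.countP_mono_left fun z _ hz => by
            rw [decide_eq_true_iff] at hz ⊢
            exact ⟨P, h1 P (by simp), hz⟩
        simp only [List.flatten_cons, List.countP_append]
        omega
    obtain ⟨P, hP, hc⟩ := h.consec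
    have hperm := List.perm_cons_erase hP
    have hnd := h.nodup
    rw [hperm.flatten.nodup_iff, List.flatten_cons, List.nodup_append] at hnd
    have hrest := hsum (𝒞.erase P) (fun Q hQ => List.mem_of_mem_erase hQ) fun Q hQ hcQ =>
      hnd.2.2 x hc.mem_left x (List.mem_flatten.2 ⟨Q, hQ, hcQ.mem_left⟩) rfl
    have hP' := h.two_mul_countP_le hu hP
    rw [if_pos hc] at hP'
    have hm : P.countP (IsLegEnd H x y u P ·) ≤ P.countP (p ·) :=
      List.countP_mono_left fun z _ hz => by
        rw [decide_eq_true_iff] at hz ⊢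
        exact ⟨P, hP, hz⟩
    rw [hperm.flatten.countP_eq, hperm.flatten.countP_eq]
    simp only [List.flatten_cons, List.countP_append]
    omega
  refine ⟨insert u (𝒞.flatten.filter (p ·)).toFinset, ?_, ?_⟩
  · intro a ha b hb _
    simp only [Finset.coe_insert, Set.mem_insert_iff, Finset.mem_coe, List.mem_toFinset,
      List.mem_filter, decide_eq_true_iff] at ha hb
    rcases ha with rfl | ⟨-, P, hP, ha⟩ <;> rcases hb with rfl | ⟨-, Q, hQ, hb⟩
    · exact H.irrefl
    · exact h.not_adj_legEnd hu hQ hb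
    · exact fun hab => h.not_adj_legEnd hu hP ha hab.symm
    · exact h.not_adj_of_isLegEnd hu hP hQ ha hb
  · rw [Finset.card_insert_of_notMem (by simp only [List.mem_toFinset, List.mem_filter]; tauto),
      List.toFinset_card_of_nodup (h.nodup.filter _), ← List.countP_eq_length_filter]
    omega

/-! ### Maximum packings span -/

theorem IsPathPacking.exists_isMaxPathPacking [Fintype V] (h : IsPathPacking H x y 𝒞) :
    ∃ 𝒟, IsMaxPathPacking H x y 𝒟 := by
  classical
  set p : ℕ → Prop := fun n => ∃ 𝒟, IsPathPacking H x y 𝒟 ∧ 𝒟.flatten.length = n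
  have hb : ∀ 𝒟, IsPathPacking H x y 𝒟 → 𝒟.flatten.length ≤ Fintype.card V :=
    fun 𝒟 h𝒟 => h𝒟.nodup.length_le_card
  obtain ⟨𝒟, h𝒟, hlen⟩ := Nat.findGreatest_spec (P := p) (hb 𝒞 h) ⟨𝒞, h, rfl⟩
  exact ⟨𝒟, h𝒟, fun 𝒬 h𝒬 => hlen ▸ Nat.le_findGreatest (hb 𝒬 h𝒬) ⟨𝒬, h𝒬, rfl⟩⟩

/-- Otherwise `v`, `u`, `w` would form a further path. -/
theorem IsMaxPathPacking.eq_of_adj_of_adj {v w : V} (h : IsMaxPathPacking H x y 𝒞)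
    (hu : u ∉ 𝒞.flatten) (hv : v ∉ 𝒞.flatten) (hw : w ∉ 𝒞.flatten) (huv : H.Adj u v)
    (huw : H.Adj u w) : v = w := by
  by_contra hne
  refine h.no_exchange (𝒬 := []) (ℛ := 𝒞) (us := [v, u, w]) (𝒩 := [[v, u, w]]) (by simp) ?_
    (by simp) (by simp [huv.symm, huw]) (by simp)
  simp only [List.nil_append, List.cons_append, List.nodup_cons, List.mem_cons, not_or]
  exact ⟨⟨huv.ne', hne, hv⟩, ⟨huw.ne, hu⟩, hw, h.nodup⟩

/-- The spanning packing behind a path factor of `G - e` through the edge `xy`. -/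
theorem exists_spanning_isPathPacking [Fintype V] {G : SimpleGraph V} [DecidableRel G.Adj]
    (hG : G.indepNum + 4 < 2 * G.minDegree) {e : Sym2 V} (hxy : (G.deleteEdges {e}).Adj x y) :
    ∃ 𝒞, IsPathPacking (G.deleteEdges {e}) x y 𝒞 ∧ ∀ v, v ∈ 𝒞.flatten := by
  classical
  have hadj : ∀ v w, (G.deleteEdges {e}).Adj v w ↔ G.Adj v w ∧ s(v, w) ≠ e := by
    simp [deleteEdges_adj]
  -- `c` is the other end of `e`, or the harmless dummy `v` when `v` is not on `e`.
  have hother : ∀ v, ∃ c, ∀ w, G.Adj v w → w ≠ c → (G.deleteEdges {e}).Adj v w := by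
    intro v
    by_cases hv : v ∈ e
    · obtain ⟨c, rfl⟩ := hv
      exact ⟨c, fun w hw hwc => (hadj v w).2 ⟨hw, fun he => hwc (Sym2.congr_right.1 he)⟩⟩
    · exact ⟨v, fun w hw _ => (hadj v w).2 ⟨hw, fun he => hv (he ▸ Sym2.mem_mk_left v w)⟩⟩
  -- The degree bound gives δ ≥ 3, so `xy` extends to a first path `z`, `x`, `y`.
  obtain ⟨z, hz, hxz⟩ : ∃ z, z ≠ y ∧ (G.deleteEdges {e}).Adj x z := by
    obtain ⟨c, hc⟩ := hother x
    have hlt : ({c, y} : Finset V).card < (G.neighborFinset x).card := by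
      have h1 := G.minDegree_le_degree x
      have h2 := Finset.card_le_two (a := c) (b := y)
      rw [card_neighborFinset_eq_degree]
      omega
    obtain ⟨z, hz, hz'⟩ := Finset.exists_mem_notMem_of_card_lt_card hlt
    simp only [Finset.mem_insert, Finset.mem_singleton, not_or] at hz'
    exact ⟨z, hz'.2, hc z ((mem_neighborFinset _ _ _).1 hz) hz'.1⟩
  have hinit : IsPathPacking (G.deleteEdges {e}) x y [[z, x, y]] := by
    refine ⟨?_, ?_, by simp, ⟨_, List.mem_singleton_self _, .inl ⟨[z], [], by simp⟩⟩⟩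
    · simp [hz, hxz.ne', hxy.ne]
    · simp only [List.mem_singleton, forall_eq, List.isChain_cons_cons, List.isChain_singleton,
        and_true]
      exact ⟨hxz.symm, hxy⟩
  obtain ⟨𝒞, h⟩ := hinit.exists_isMaxPathPacking
  refine ⟨𝒞, h.toIsPathPacking, ?_⟩
  by_contra! hne
  have hcount : ∀ v c, (∀ w, G.Adj v w → w ≠ c → (G.deleteEdges {e}).Adj v w ∧ w ∈ 𝒞.flatten) →
      G.minDegree ≤ 𝒞.flatten.countP ((G.deleteEdges {e}).Adj v ·) + 1 := by
    intro v c hc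
    have hsub : (G.neighborFinset v).erase c ⊆
        (𝒞.flatten.filter ((G.deleteEdges {e}).Adj v ·)).toFinset := by
      intro w hw
      rw [Finset.mem_erase, mem_neighborFinset] at hw
      rw [List.mem_toFinset, List.mem_filter, decide_eq_true_iff]
      exact (hc w hw.2 hw.1).symm
    have h1 := (Finset.card_le_card hsub).trans (List.toFinset_card_le _)
    rw [← List.countP_eq_length_filter] at h1
    have h2 := Finset.pred_card_le_card_erase (s := G.neighborFinset v) (a := c)
    have h3 := G.minDegree_le_degree v
    rw [card_neighborFinset_eq_degree] at h2
    omega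
  have hboth : ∀ v w, v ∉ 𝒞.flatten → w ∉ 𝒞.flatten → (G.deleteEdges {e}).Adj v w → v ∉ e →
      G.minDegree ≤ 𝒞.flatten.countP ((G.deleteEdges {e}).Adj v ·) + 1 := by
    intro v w hv hw hvw hve
    refine hcount v w fun t hvt htw => ?_
    have hvt' : (G.deleteEdges {e}).Adj v t :=
      (hadj v t).2 ⟨hvt, fun he => hve (he ▸ Sym2.mem_mk_left v t)⟩
    refine ⟨hvt', ?_⟩
    by_contra ht
    exact htw (h.eq_of_adj_of_adj hv ht hw hvt' hvw)
  -- An uncovered edge of `G - e` has an end off `e`, which loses only the other end. An uncovered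
  -- vertex on no such edge loses at most its partner in `e`.
  obtain ⟨u, hu, hdeg⟩ : ∃ u, u ∉ 𝒞.flatten ∧
      G.minDegree ≤ 𝒞.flatten.countP ((G.deleteEdges {e}).Adj u ·) + 1 := by
    obtain ⟨u, hu⟩ := hne
    by_cases hv : ∃ v, v ∉ 𝒞.flatten ∧ (G.deleteEdges {e}).Adj u v
    · obtain ⟨v, hv, huv⟩ := hv
      by_cases hue : u ∈ e
      · refine ⟨v, hv, hboth v u hv hu huv.symm fun hve => ?_⟩
        exact ((hadj u v).1 huv).2 ((Sym2.mem_and_mem_iff huv.ne).1 ⟨hue, hve⟩).symm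
      · exact ⟨u, hu, hboth u v hu hv huv hue⟩
    · push Not at hv
      obtain ⟨c, hc⟩ := hother u
      refine ⟨u, hu, hcount u c fun w huw hwc => ⟨hc w huw hwc, ?_⟩⟩
      by_contra hw
      exact hv w hw (hc w huw hwc)
  obtain ⟨I, hI, hcard⟩ := h.exists_isIndepSet hu
  replace hcard : 2 * 𝒞.flatten.countP ((G.deleteEdges {e}).Adj u ·) ≤ I.card + 1 := by
    convert hcard
  induction e with | _ a b => ?_
  -- Only `e` can join two vertices of `I` in `G`, so one end of it is dropped.
  have hI' : G.IsIndepSet (I.erase a : Finset V) := by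
    intro p hp q hq hpq hGpq
    simp only [Finset.coe_erase, Set.mem_sdiff, Finset.mem_coe, Set.mem_singleton_iff] at hp hq
    refine hI hp.1 hq.1 hpq ((hadj p q).2 ⟨hGpq, fun he => ?_⟩)
    rcases Sym2.mem_iff.1 (he ▸ Sym2.mem_mk_left a b : a ∈ s(p, q)) with ha | ha
    · exact hp.2 ha.symm
    · exact hq.2 ha.symm
  have h1 := hI'.card_le_indepNum
  have h2 := Finset.pred_card_le_card_erase (s := I) (a := a)
  omega

/-! ### From spanning packings to path factors -/

/-- The graph whose edges join consecutive vertices of the lists of `𝒞`. -/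
def packingGraph (𝒞 : List (List V)) : SimpleGraph V where
  Adj a b := a ≠ b ∧ ∃ P ∈ 𝒞, Consec a b P
  symm := ⟨fun _ _ h => ⟨h.1.symm, let ⟨P, hP, hc⟩ := h.2; ⟨P, hP, hc.symm⟩⟩⟩
  loopless := ⟨fun _ h => h.1 rfl⟩

theorem pair_infix_iff_getElem {a b : V} {l : List V} :
    [a, b] <:+: l ↔ ∃ (k : ℕ) (hk : k + 1 < l.length), l[k] = a ∧ l[k + 1] = b := by
  constructor
  · rintro ⟨s, t, rfl⟩
    exact ⟨s.length, by simp, by simp, by simp⟩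
  · rintro ⟨k, hk, rfl, rfl⟩
    refine ⟨l.take k, l.drop (k + 2), ?_⟩
    conv_rhs => rw [← List.take_append_drop k l]
    rw [List.drop_eq_getElem_cons (by omega : k < l.length), List.drop_eq_getElem_cons hk]
    simp

theorem consec_getElem_iff {l : List V} (hl : l.Nodup) {i j : ℕ} (hi : i < l.length)
    (hj : j < l.length) : Consec l[i] l[j] l ↔ i + 1 = j ∨ j + 1 = i := by
  have key : ∀ {i j : ℕ} (hi : i < l.length) (hj : j < l.length),
      [l[i], l[j]] <:+: l ↔ i + 1 = j := by
    intro i j hi hj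
    rw [pair_infix_iff_getElem]
    constructor
    · rintro ⟨k, hk, h1, h2⟩
      rw [hl.getElem_inj_iff] at h1 h2
      omega
    · rintro rfl
      exact ⟨i, hj, rfl, rfl⟩
  rw [Consec, key, key]

theorem eq_of_mem_of_mem_of_nodup_flatten (h : 𝒞.flatten.Nodup) {P Q : List V} (hP : P ∈ 𝒞)
    (hQ : Q ∈ 𝒞) {a : V} (haP : a ∈ P) (haQ : a ∈ Q) : P = Q := by
  classical
  by_contra hne
  rw [(List.perm_cons_erase hP).flatten.nodup_iff, List.flatten_cons, List.nodup_append] at h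
  exact h.2.2 a haP a
    (List.mem_flatten.2 ⟨Q, (List.mem_erase_of_ne (Ne.symm hne)).2 hQ, haQ⟩) rfl

/-- Disjointness makes each list closed under adjacency, so the lists are the components, and the
position in the list is the isomorphism. -/
theorem IsPathPacking.isPathFactor (h : IsPathPacking H x y 𝒞) (hs : ∀ v, v ∈ 𝒞.flatten) :
    IsPathFactor 3 H (packingGraph 𝒞) := by
  classical
  refine ⟨?_, fun C => ?_⟩
  · rintro a b ⟨-, P, hP, hc | hc⟩
    · simpa using (h.isChain P hP).infix hc
    · simpa using ((h.isChain P hP).infix hc : List.IsChain H.Adj [b, a]).rel.symm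
  obtain ⟨v, rfl⟩ := C.exists_rep
  obtain ⟨P, hP, hvP⟩ := List.mem_flatten.1 (hs v)
  have hnd : P.Nodup := (List.nodup_flatten.1 h.nodup).1 P hP
  have hadj : ∀ i j (hi : i < P.length) (hj : j < P.length),
      (packingGraph 𝒞).Adj P[i] P[j] ↔ i + 1 = j ∨ j + 1 = i := by
    intro i j hi hj
    rw [← consec_getElem_iff hnd hi hj]
    constructor
    · rintro ⟨-, Q, hQ, hc⟩
      obtain rfl := eq_of_mem_of_mem_of_nodup_flatten h.nodup hP hQ (List.getElem_mem hi) hc.mem_left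
      exact hc
    · intro hc
      refine ⟨fun he => ?_, P, hP, hc⟩
      rw [hnd.getElem_inj_iff] at he
      rw [consec_getElem_iff hnd hi hj] at hc
      omega
  have hclosed : ∀ w, (packingGraph 𝒞).Reachable v w → w ∈ P := by
    rintro w ⟨p⟩
    induction p with
    | nil => exact hvP
    | cons hab _ ih =>
      obtain ⟨-, Q, hQ, hc⟩ := hab
      refine ih ?_
      rw [eq_of_mem_of_mem_of_nodup_flatten h.nodup hP hQ hvP hc.mem_left]
      exact hc.mem_right
  have hpos : 0 < P.length := by have := h.three_le P hP; omega
  have hreach0 : ∀ i (hi : i < P.length), (packingGraph 𝒞).Reachable P[0] P[i] := by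
    intro i
    induction i with
    | zero => exact fun _ => .refl _
    | succ i ih =>
      exact fun hi => (ih (by omega)).trans
        ((hadj i (i + 1) (by omega) hi).2 (.inl rfl)).reachable
  have hreach : ∀ w ∈ P, (packingGraph 𝒞).Reachable w v := by
    intro w hw
    obtain ⟨i, hi, rfl⟩ := List.getElem_of_mem hw
    obtain ⟨j, hj, rfl⟩ := List.getElem_of_mem hvP
    exact (hreach0 i hi).symm.trans (hreach0 j hj)
  refine ⟨P.length, h.three_le P hP, ⟨RelIso.symm ⟨Equiv.ofBijective
    (fun i : Fin P.length => ⟨P[i], ConnectedComponent.sound (hreach _ (List.getElem_mem i.2))⟩)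
    ⟨?_, ?_⟩, ?_⟩⟩⟩
  · intro i j hij
    simp only [Fin.getElem_fin, Subtype.mk.injEq] at hij
    exact Fin.ext (hnd.getElem_inj_iff.1 hij)
  · rintro ⟨w, hw⟩
    obtain ⟨i, hi, rfl⟩ := List.getElem_of_mem (hclosed w (ConnectedComponent.exact hw).symm)
    exact ⟨⟨i, hi⟩, rfl⟩
  · intro i j
    rw [pathGraph_adj]
    exact hadj i j i.2 j.2

theorem isPathFactorUniform_three [Fintype V] {G : SimpleGraph V} [DecidableRel G.Adj]
    (hG : G.indepNum + 4 < 2 * G.minDegree) : G.IsPathFactorUniform 3 := by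
  intro e _ f hf
  induction f with | _ x y => ?_
  obtain ⟨𝒞, h, hs⟩ := exists_spanning_isPathPacking hG hf
  obtain ⟨P, hP, hc⟩ := h.consec
  exact ⟨packingGraph 𝒞, h.isPathFactor hs, (G.deleteEdges {e}).ne_of_adj hf, P, hP, hc⟩

end Packing

/-! ### Local constraints on path factors -/

section PathFactor

variable {V : Type*} {H F : SimpleGraph V} {d : ℕ}

theorem IsPathFactor.degree_le_two [Fintype V] [DecidableRel F.Adj] (h : IsPathFactor d H F)
    (v : V) : F.degree v ≤ 2 := by
  obtain ⟨n, -, ⟨φ⟩⟩ := h.2 (F.connectedComponentMk v)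
  by_contra! hlt
  rw [← card_neighborFinset_eq_degree, Finset.two_lt_card] at hlt
  obtain ⟨a, ha, b, hb, c, hc, hab, hac, hbc⟩ := hlt
  rw [mem_neighborFinset] at ha hb hc
  have hmem : ∀ {w}, F.Adj v w → w ∈ (F.connectedComponentMk v).supp := fun hw =>
    ConnectedComponent.sound hw.reachable.symm
  have hφ : ∀ {w} (hw : F.Adj v w), (φ ⟨v, rfl⟩ : ℕ) + 1 = φ ⟨w, hmem hw⟩ ∨
      (φ ⟨w, hmem hw⟩ : ℕ) + 1 = φ ⟨v, rfl⟩ := by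
    intro w hw
    have hC : (F.connectedComponentMk v).toSimpleGraph.Adj ⟨v, rfl⟩ ⟨w, hmem hw⟩ := hw
    exact pathGraph_adj.1 (φ.map_adj_iff.2 hC)
  have hinj : ∀ {w w'} (hw : F.Adj v w) (hw' : F.Adj v w'), w ≠ w' →
      (φ ⟨w, hmem hw⟩ : ℕ) ≠ φ ⟨w', hmem hw'⟩ := by
    intro w w' hw hw' hne he
    exact hne (congrArg Subtype.val (φ.injective (Fin.ext he)))
  have h1 := hinj ha hb hab
  have h2 := hinj ha hc hac
  have h3 := hinj hb hc hbc
  have h4 := hφ ha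
  have h5 := hφ hb
  have h6 := hφ hc
  omega

/-- Otherwise the component of `v` would lie in `{v, w}`. The case `v = w` serves for one-vertex
pieces. -/
theorem IsPathFactor.exists_adj_of_two_lt (h : IsPathFactor d H F) (hd : 2 < d) (v w : V) :
    ∃ a b, (a = v ∨ a = w) ∧ F.Adj a b ∧ b ≠ v ∧ b ≠ w := by
  by_contra! hcl
  obtain ⟨n, hn, ⟨φ⟩⟩ := h.2 (F.connectedComponentMk v)
  have hreach : ∀ {a b}, F.Walk a b → (a = v ∨ a = w) → b = v ∨ b = w := by
    intro a b p
    induction p with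
    | nil => exact id
    | @cons a b c hab _ ih =>
      intro ha
      exact ih (or_iff_not_imp_left.2 fun hb => hcl a b ha hab hb)
  have hsub : (F.connectedComponentMk v).supp ⊆ {v, w} := fun b hb => by
    obtain ⟨p⟩ := (ConnectedComponent.exact hb).symm
    exact hreach p (.inl rfl)
  have h1 : (F.connectedComponentMk v).supp.ncard = n := by
    rw [← Nat.card_coe_set_eq]
    exact (Nat.card_congr φ.toEquiv).trans (Nat.card_fin n)
  have h2 := Set.ncard_le_ncard hsub
  have h3 := Set.ncard_insert_le v {w}
  rw [Set.ncard_singleton] at h3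
  omega

end PathFactor

/-! ### The extremal join -/

section Join

variable {n m : ℕ}

@[simp] theorem graphJoin_adj_inl_inl {V W : Type*} {G : SimpleGraph V} {H : SimpleGraph W}
    {a b : V} : (graphJoin G H).Adj (.inl a) (.inl b) ↔ G.Adj a b := by
  simp [graphJoin]

@[simp] theorem graphJoin_adj_inr_inr {V W : Type*} {G : SimpleGraph V} {H : SimpleGraph W}
    {a b : W} : (graphJoin G H).Adj (.inr a) (.inr b) ↔ H.Adj a b := by
  simp [graphJoin]

@[simp] theorem graphJoin_adj_inl_inr {V W : Type*} {G : SimpleGraph V} {H : SimpleGraph W}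
    {a : V} {b : W} : (graphJoin G H).Adj (.inl a) (.inr b) := by
  simp [graphJoin]

@[simp] theorem graphJoin_adj_inr_inl {V W : Type*} {G : SimpleGraph V} {H : SimpleGraph W}
    {a : V} {b : W} : (graphJoin G H).Adj (.inr b) (.inl a) := by
  simp [graphJoin]

theorem copiesK2_adj {v w : Fin m × Fin 2} :
    (copiesK2 m).Adj v w ↔ v.1 = w.1 ∧ v.2 ≠ w.2 := Iff.rfl

/-- Some clique vertex avoids both ends of the deleted edge and stays adjacent to all others. -/
theorem isEdgeConnected_two_graphJoin {W : Type*} (hn : 3 ≤ n) (H : SimpleGraph W) :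
    (graphJoin (⊤ : SimpleGraph (Fin n)) H).IsEdgeConnected 2 := by
  classical
  refine (isEdgeConnected_add_one one_ne_zero).2 fun e => isEdgeConnected_one.2 ?_
  obtain ⟨c, hc⟩ : ∃ c : Fin n, (.inl c : Fin n ⊕ W) ∉ e := by
    by_contra! hall
    induction e with | _ a b => ?_
    have hsub : (Finset.univ.map Function.Embedding.inl : Finset (Fin n ⊕ W)) ⊆ {a, b} := by
      intro z hz
      obtain ⟨c, -, rfl⟩ := Finset.mem_map.1 hz
      simpa using hall c
    have h1 := Finset.card_le_card hsub
    have h2 := Finset.card_le_two (a := a) (b := b)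
    rw [Finset.card_map, Finset.card_univ, Fintype.card_fin] at h1
    omega
  have hreach : ∀ v, ((graphJoin (⊤ : SimpleGraph (Fin n)) H).deleteEdges {e}).Reachable
      (.inl c) v := by
    intro v
    by_cases hv : .inl c = v
    · rw [hv]
    · refine Adj.reachable (deleteEdges_adj.2 ⟨?_, fun he => hc ?_⟩)
      · rcases v with a | a
        · simpa using fun h => hv (congrArg Sum.inl h)
        · simp
      · rw [Set.mem_singleton_iff] at he
        exact he ▸ Sym2.mem_mk_left _ _
  exact fun u v => (hreach u).symm.trans (hreach v)

theorem minDegree_graphJoin_copiesK2 (hm : 0 < m) (hnm : n + 1 ≤ m * 2)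
    [DecidableRel (graphJoin (⊤ : SimpleGraph (Fin n)) (copiesK2 m)).Adj] :
    (graphJoin (⊤ : SimpleGraph (Fin n)) (copiesK2 m)).minDegree = n + 1 := by
  have : Nonempty (Fin n ⊕ (Fin m × Fin 2)) := ⟨.inr (⟨0, hm⟩, 0)⟩
  have hdeg : ∀ w : Fin m × Fin 2,
      (graphJoin (⊤ : SimpleGraph (Fin n)) (copiesK2 m)).degree (.inr w) = n + 1 := by
    rintro ⟨i, j⟩
    rw [← card_neighborFinset_eq_degree]
    have : (graphJoin (⊤ : SimpleGraph (Fin n)) (copiesK2 m)).neighborFinset (.inr (i, j)) =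
        Finset.univ.disjSum {(i, 1 - j)} := by
      ext v
      rcases v with a | ⟨k, l⟩
      · simp
      · simp only [mem_neighborFinset, graphJoin_adj_inr_inr, copiesK2_adj, Finset.inr_mem_disjSum,
          Finset.mem_singleton, Prod.mk.injEq, eq_comm (a := k)]
        refine and_congr_right fun _ => ?_
        fin_cases j <;> fin_cases l <;> simp
    rw [this, Finset.card_disjSum]
    simp
  refine le_antisymm (hdeg (⟨0, hm⟩, 0) ▸ minDegree_le_degree _ _)
    (le_minDegree_of_forall_le_degree _ _ ?_)
  rintro (a | w)
  · rw [← card_neighborFinset_eq_degree]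
    have hsub : Finset.univ.map Function.Embedding.inr ⊆
        (graphJoin (⊤ : SimpleGraph (Fin n)) (copiesK2 m)).neighborFinset (.inl a) := by
      intro z hz
      obtain ⟨c, -, rfl⟩ := Finset.mem_map.1 hz
      simp
    have := Finset.card_le_card hsub
    simp only [Finset.card_map, Finset.card_univ, Fintype.card_prod, Fintype.card_fin] at this
    omega
  · exact (hdeg w).ge

theorem indepNum_graphJoin_copiesK2 (hm : 0 < m) :
    (graphJoin (⊤ : SimpleGraph (Fin n)) (copiesK2 m)).indepNum = m := by
  apply le_antisymm
  · obtain ⟨I, hI⟩ :=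
      (graphJoin (⊤ : SimpleGraph (Fin n)) (copiesK2 m)).exists_isNIndepSet_indepNum
    rw [← hI.card_eq]
    -- Sending clique vertices to the arbitrary index 0 is safe: they are adjacent to every other
    -- vertex.
    have hcard := Finset.card_le_card_of_injOn (s := I) (t := (Finset.univ : Finset (Fin m)))
      (Sum.elim (fun _ => ⟨0, hm⟩) Prod.fst) (by simp) ?_
    · simpa using hcard
    intro v hv w hw hvw
    by_contra hne
    refine hI.isIndepSet hv hw hne ?_
    rcases v with a | ⟨i, j⟩ <;> rcases w with b | ⟨k, l⟩
    · simpa using hne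
    · simp
    · simp
    · simp only [Sum.elim_inr] at hvw
      subst hvw
      simpa [copiesK2] using hne
  · have hI : (graphJoin (⊤ : SimpleGraph (Fin n)) (copiesK2 m)).IsIndepSet
        ((Finset.univ : Finset (Fin m)).map
          (⟨fun i => .inr (i, 0), fun i j h => by simpa using h⟩ :
            Fin m ↪ Fin n ⊕ (Fin m × Fin 2)) : Finset _) := by
      intro v hv w hw _
      simp only [Finset.coe_map, Set.mem_image] at hv hw
      obtain ⟨i, -, rfl⟩ := hv
      obtain ⟨j, -, rfl⟩ := hw
      exact fun hij => (copiesK2_adj.1 (graphJoin_adj_inr_inr.1 hij)).2 rfl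
    simpa using hI.card_le_indepNum

theorem not_isPathFactorUniform_graphJoin_copiesK2 (hn : 2 ≤ n) (hm : 0 < m)
    (hnm : 2 * n ≤ m + 2) :
    ¬ (graphJoin (⊤ : SimpleGraph (Fin n)) (copiesK2 m)).IsPathFactorUniform 3 := by
  classical
  intro h
  set x₀ : Fin n := ⟨0, by omega⟩
  set x₁ : Fin n := ⟨1, by omega⟩
  have hx : x₀ ≠ x₁ := by simp [x₀, x₁]
  set i₀ : Fin m := ⟨0, hm⟩
  obtain ⟨F, hF, hxF⟩ := h s(.inr (i₀, 0), .inr (i₀, 1)) (by simp [copiesK2])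
    s(.inl x₀, .inl x₁) (by simp [hx])
  rw [mem_edgeSet] at hxF
  -- the components left after deleting the edge and the clique
  set π : Fin m × Fin 2 → Option (Fin m) := fun w => if w = (i₀, 1) then none else some w.1
  have hπ : ∀ v w, F.Adj (.inr v) (.inr w) → π v = π w := by
    rintro ⟨i, j⟩ ⟨k, l⟩ hvw
    obtain ⟨hvw, hne⟩ := deleteEdges_adj.1 (hF.1 hvw)
    simp only [graphJoin_adj_inr_inr, copiesK2] at hvw
    obtain ⟨rfl, hjl⟩ := hvw
    by_cases hi : i = i₀
    · subst hi
      exfalso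
      apply hne
      fin_cases j <;> fin_cases l <;> simp_all
    · simp [π, hi]
  -- A piece has at most two vertices, so `F` must leave it, and can do so only into the clique.
  have hsurj : ∀ c, ∃ x w, F.Adj (.inl x) (.inr w) ∧ π w = c := by
    intro c
    obtain ⟨v, w, hv, hw, hfib⟩ : ∃ v w, π v = c ∧ π w = c ∧ ∀ z, π z = c → z = v ∨ z = w := by
      rcases c with _ | i
      · exact ⟨(i₀, 1), (i₀, 1), by simp [π], by simp [π], fun z hz => by simpa [π] using hz⟩
      · by_cases hi : i = i₀
        · subst hi
          refine ⟨(i₀, 0), (i₀, 0), by simp [π], by simp [π], fun z hz => ?_⟩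
          obtain ⟨k, l⟩ := z
          fin_cases l <;> simp_all [π]
        · refine ⟨(i, 0), (i, 1), by simp [π], by simp [π, hi], fun z hz => ?_⟩
          obtain ⟨k, l⟩ := z
          fin_cases l <;> simp_all [π]
    obtain ⟨a, b, ha, hab, hbv, hbw⟩ := hF.exists_adj_of_two_lt (by norm_num) (.inr v) (.inr w)
    obtain ⟨z, rfl, hz⟩ : ∃ z, a = .inr z ∧ π z = c := by
      rcases ha with rfl | rfl
      · exact ⟨v, rfl, hv⟩
      · exact ⟨w, rfl, hw⟩
    rcases b with x | b
    · exact ⟨x, z, hab.symm, hz⟩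
    · rcases hfib b ((hπ _ _ hab).symm.trans hz) with rfl | rfl
      · exact absurd rfl hbv
      · exact absurd rfl hbw
  set N : Fin n → Finset (Fin m × Fin 2) := fun x => Finset.univ.filter
    fun w => F.Adj (.inl x) (.inr w)
  have hlow : m + 1 ≤ ∑ x, (N x).card := by
    rw [← Finset.card_sigma]
    have := Finset.card_le_card_of_surjOn (s := Finset.univ.sigma N)
      (t := (Finset.univ : Finset (Option (Fin m)))) (fun p => π p.2) (by
        intro c _
        obtain ⟨x, w, hxw, hc⟩ := hsurj c
        exact ⟨⟨x, w⟩, by simp [N, hxw], hc⟩)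
    simpa using this
  -- The edge `x₀x₁` uses one of the two places at each of its ends. Summing gives `(m + 1) + 2 ≤ 2
  -- * n`, against `hnm`.
  have hle : ∀ x, (N x).card + (if x = x₀ ∨ x = x₁ then 1 else 0) ≤ 2 := by
    intro x
    have hdeg := hF.degree_le_two (.inl x)
    rw [← card_neighborFinset_eq_degree] at hdeg
    refine le_trans ?_ hdeg
    have key : ∀ s : Finset (Fin n), (∀ y ∈ s, F.Adj (.inl x) (.inl y)) →
        (N x).card + s.card ≤ (F.neighborFinset (.inl x)).card := by
      intro s hs
      rw [add_comm, ← Finset.card_disjSum]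
      refine Finset.card_le_card fun v hv => ?_
      rw [mem_neighborFinset]
      rcases v with y | w
      · exact hs y (by simpa using hv)
      · simpa [N] using hv
    split_ifs with hc
    · rcases hc with rfl | rfl
      · exact key {x₁} (by simpa using hxF)
      · exact key {x₀} (by simpa using hxF.symm)
    · exact key ∅ (by simp)
  have hsum := Finset.sum_le_sum fun x (_ : x ∈ Finset.univ) => hle x
  rw [Finset.sum_add_distrib, Finset.sum_boole, Finset.sum_const, Finset.card_univ,
    Fintype.card_fin, Finset.filter_or, Finset.filter_eq', Finset.filter_eq'] at hsum
  simp only [Finset.mem_univ, if_true, Finset.singleton_union, Finset.card_pair hx, Nat.cast_id,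
    smul_eq_mul] at hsum
  omega

end Join

end SimpleGraph

theorem theorem1p3 :
    (∀ (V : Type*) [Fintype V] (G : SimpleGraph V) [DecidableRel G.Adj],
      G.IsEdgeConnected 2 →
      (G.minDegree : ℚ) > ((G.indepNum : ℚ) + 4) / 2 →
      G.IsPathFactorUniform 3) ∧
    (∀ (t : ℕ) (G : SimpleGraph (Fin (3 + t) ⊕ (Fin (4 + 2 * t) × Fin 2))) [DecidableRel G.Adj],
      G = SimpleGraph.graphJoin (⊤ : SimpleGraph (Fin (3 + t))) (SimpleGraph.copiesK2 (4 + 2 * t)) →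
      G.IsEdgeConnected 2 ∧
      (G.minDegree : ℚ) = ((G.indepNum : ℚ) + 4) / 2 ∧
      ¬ G.IsPathFactorUniform 3) := by
  refine ⟨fun V _ G _ _ hG => SimpleGraph.isPathFactorUniform_three ?_, fun t G _ hG => ?_⟩
  · rw [gt_iff_lt, div_lt_iff₀ two_pos] at hG
    rw [mul_comm]
    exact_mod_cast hG
  · subst hG
    refine ⟨SimpleGraph.isEdgeConnected_two_graphJoin (by omega) _, ?_,
      SimpleGraph.not_isPathFactorUniform_graphJoin_copiesK2 (by omega) (by omega) (by omega)⟩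
    rw [SimpleGraph.minDegree_graphJoin_copiesK2 (by omega) (by omega),
      SimpleGraph.indepNum_graphJoin_copiesK2 (by omega)]
    push_cast
    ring
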